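/- Let $q\in(0,1)$ and let $l\ge 1$ be an integer. Let $\mathcal O(SU_q(2))$ be the unital complex $*$-algebra generated by $\alpha,\beta$ subject to $$\alpha\beta=q\beta\alpha,\quad \alpha\beta^*=q\beta^*\alpha,\quad \beta\beta^*=\beta^*\beta,\quad \alpha\alpha^*=\alpha^*\alpha+(q^{-2}-1)\beta\beta^*,\quad \alpha\alpha^*+\beta\beta^*=1 .$$ Let $\mathcal O(\mathbb Z_l)$ be the complex group algebra of the cyclic group of order $l$ with generator $w$, and let $\mathcal O(L_q(l;1,l))$ be the subalgebra of those $x\in\mathcal O(SU_q(2))$ with $\varrho(x)=x\otimes 1$, where $\varrho:\mathcal O(SU_q(2))\to\mathcal O(SU_q(2))\otimes\mathcal O(\mathbb Z_l)$ is the $*$-algebra map with $\varrho(\alpha)=\alpha\otimes w$, $\varrho(\beta)=\beta\otimes 1$. Put $c=\alpha^l$, $d=\beta$. Regard $\mathcal O(L_q(l;1,l))$ as a right comodule algebra over the Hopf algebra $\mathcal O(U(1))=\mathbb C[u,u^*]$, $u^*=u^{-1}$ (with $u$ grouplike), by the coaction $\varrho_l$ determined by $c\mapsto c\otimes u$, $d\mapsto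 d\otimes u^*$; equivalently, $(\iota\otimes(-)^l)\circ\varrho_l=\varrho_{1,l}\circ\iota$, where $\iota$ is the inclusion into $\mathcal O(SU_q(2))$, $(-)^l$ is the algebra map $u\mapsto u^l$, and $\varrho_{1,l}:\mathcal O(SU_q(2))\to\mathcal O(SU_q(2))\otimes\mathcal O(U(1))$ is the $*$-algebra map $\alpha\mapsto\alpha\otimes u$, $\beta\mapsto\beta\otimes u^{-l}$. Then the invertible elements of $\mathcal O(L_q(l;1,l))$ are exactly the nonzero scalar multiples of $1$, and the $\mathcal O(U(1))$-comodule algebra $\mathcal O(L_q(l;1,l))$ is not cleft: there is no linear map $j:\mathcal O(U(1))\to\mathcal O(L_q(l;1,l))$ that is right $\mathcal O(U(1))$-colinear, invertible for the convolution product, and satisfies $j(1)=1$. -/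

import Mathlib

open scoped TensorProduct LaurentPolynomial

noncomputable section

namespace QuantumLens

/-! ### Comodule algebras, coinvariants, cleftness -/

/-- A right `H`-comodule algebra structure on `A`: a coaction `A → A ⊗ H` which is an algebra map,
coassociative and counital. -/
structure ComoduleAlgebra (R H A : Type*) [CommRing R] [Ring H] [Bialgebra R H] [Ring A]
    [Algebra R A] where
  /-- The coaction. -/
  coact : A →ₐ[R] A ⊗[R] H
  coassoc : ∀ x : A,
    TensorProduct.assoc R A H H (coact.toLinearMap.rTensor H (coact x)) =
      (Coalgebra.comul (R := R) (A := H)).lTensor A (coact x)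
  counital : ∀ x : A,
    TensorProduct.rid R A ((Coalgebra.counit (R := R) (A := H)).lTensor A (coact x)) = x

namespace ComoduleAlgebra

variable {R H A : Type*} [CommRing R] [Ring H] [Bialgebra R H] [Ring A] [Algebra R A]

/-- The subalgebra of coinvariants `{x | coact x = x ⊗ 1}`. -/
def coinvariants (ρ : ComoduleAlgebra R H A) : Subalgebra R A :=
  AlgHom.equalizer ρ.coact Algebra.TensorProduct.includeLeft

/-- A linear map `j : H → A` is right `H`-colinear if `coact ∘ j = (j ⊗ id) ∘ Δ`. -/
def IsColinear (ρ : ComoduleAlgebra R H A) (j : H →ₗ[R] A) : Prop :=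
  ρ.coact.toLinearMap ∘ₗ j = j.rTensor H ∘ₗ Coalgebra.comul

/-- A comodule algebra is cleft if there is a right colinear map `j : H → A` with `j 1 = 1` that is
invertible for the convolution product. -/
def IsCleft (ρ : ComoduleAlgebra R H A) : Prop :=
  ∃ j : H →ₗ[R] A, IsUnit (WithConv.toConv j) ∧ ρ.IsColinear j ∧ j 1 = 1

end ComoduleAlgebra

/-! ### The coordinate algebra of quantum `SU(2)` -/

/-- Generators `α, α*, β, β*`. -/
inductive SUGen : Type
  | a | aStar | b | bStar

open FreeAlgebra in
/-- The defining relations of the `*`-algebra `O(SU_q(2))`, as relations between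
`α, α*, β, β*`; the list is closed under taking adjoints. -/
inductive SURel (q : ℝ) : FreeAlgebra ℂ SUGen → FreeAlgebra ℂ SUGen → Prop
  /-- `α β = q β α` -/
  | ab : SURel q (ι ℂ .a * ι ℂ .b) ((q : ℂ) • (ι ℂ .b * ι ℂ .a))
  /-- `β* α* = q α* β*` -/
  | ab_adj : SURel q (ι ℂ .bStar * ι ℂ .aStar) ((q : ℂ) • (ι ℂ .aStar * ι ℂ .bStar))
  /-- `α β* = q β* α` -/
  | abStar : SURel q (ι ℂ .a * ι ℂ .bStar) ((q : ℂ) • (ι ℂ .bStar * ι ℂ .a))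
  /-- `β α* = q α* β` -/
  | abStar_adj : SURel q (ι ℂ .b * ι ℂ .aStar) ((q : ℂ) • (ι ℂ .aStar * ι ℂ .b))
  /-- `β β* = β* β` -/
  | bbStar : SURel q (ι ℂ .b * ι ℂ .bStar) (ι ℂ .bStar * ι ℂ .b)
  /-- `α α* = α* α + (q⁻² - 1) β β*` -/
  | aaStar : SURel q (ι ℂ .a * ι ℂ .aStar)
      (ι ℂ .aStar * ι ℂ .a + (((q : ℂ) ^ 2)⁻¹ - 1) • (ι ℂ .b * ι ℂ .bStar))
  /-- `α α* + β β* = 1` -/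
  | sphere : SURel q (ι ℂ .a * ι ℂ .aStar + ι ℂ .b * ι ℂ .bStar) 1

/-- The algebra `O(SU_q(2))`, the same as `O(S³_q)`. -/
abbrev SUq (q : ℝ) : Type := RingQuot (SURel q)

namespace SUq

variable {q : ℝ}

/-- The image of a generator in `O(SU_q(2))`. -/
def gen (q : ℝ) (s : SUGen) : SUq q := RingQuot.mkAlgHom ℂ (SURel q) (FreeAlgebra.ι ℂ s)

/-- The generator `α`. -/
def α (q : ℝ) : SUq q := gen q .a
/-- The generator `α*`. -/
def αStar (q : ℝ) : SUq q := gen q .aStar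
/-- The generator `β`. -/
def β (q : ℝ) : SUq q := gen q .b
/-- The generator `β*`. -/
def βStar (q : ℝ) : SUq q := gen q .bStar

lemma α_mul_β : α q * β q = (q : ℂ) • (β q * α q) := by
  have h := RingQuot.mkAlgHom_rel ℂ (SURel.ab (q := q))
  simp only [map_mul, map_smul] at h
  exact h

lemma βStar_mul_αStar : βStar q * αStar q = (q : ℂ) • (αStar q * βStar q) := by
  have h := RingQuot.mkAlgHom_rel ℂ (SURel.ab_adj (q := q))
  simp only [map_mul, map_smul] at h
  exact h

lemma α_mul_βStar : α q * βStar q = (q : ℂ) • (βStar q * α q) := by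
  have h := RingQuot.mkAlgHom_rel ℂ (SURel.abStar (q := q))
  simp only [map_mul, map_smul] at h
  exact h

lemma β_mul_αStar : β q * αStar q = (q : ℂ) • (αStar q * β q) := by
  have h := RingQuot.mkAlgHom_rel ℂ (SURel.abStar_adj (q := q))
  simp only [map_mul, map_smul] at h
  exact h

lemma β_mul_βStar : β q * βStar q = βStar q * β q := by
  simpa [β, βStar, gen] using RingQuot.mkAlgHom_rel ℂ (SURel.bbStar (q := q))

lemma α_mul_αStar :
    α q * αStar q = αStar q * α q + (((q : ℂ) ^ 2)⁻¹ - 1) • (β q * βStar q) := by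
  have h := RingQuot.mkAlgHom_rel ℂ (SURel.aaStar (q := q))
  simp only [map_mul, map_add, map_smul] at h
  exact h

lemma sphere : α q * αStar q + β q * βStar q = 1 := by
  simpa [α, αStar, β, βStar, gen] using RingQuot.mkAlgHom_rel ℂ (SURel.sphere (q := q))

/-- Two algebra maps out of `O(SU_q(2))` agreeing on the generators are equal. -/
lemma algHom_ext {B : Type*} [Semiring B] [Algebra ℂ B] {f g : SUq q →ₐ[ℂ] B}
    (h : ∀ s, f (gen q s) = g (gen q s)) : f = g := by
  apply RingQuot.ringQuot_ext'
  apply FreeAlgebra.hom_ext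
  funext s
  exact h s

/-- The weight of a generator when `α` has weight `m` and `β` has weight `n`. -/
def weight {G : Type} [AddCommGroup G] (m n : G) : SUGen → G
  | .a => m
  | .aStar => -m
  | .b => n
  | .bStar => -n

open AddMonoidAlgebra in
/-- The algebra map `O(SU_q(2)) → O(SU_q(2)) ⊗ ℂ[G]` with `α ↦ α ⊗ m`, `α* ↦ α* ⊗ m⁻¹`,
`β ↦ β ⊗ n`, `β* ↦ β* ⊗ n⁻¹`, where `m, n` are elements of the commutative group `G` (which is
written additively). -/
def coactHom (q : ℝ) {G : Type} [AddCommGroup G] (m n : G) :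
    SUq q →ₐ[ℂ] SUq q ⊗[ℂ] AddMonoidAlgebra ℂ G :=
  RingQuot.liftAlgHom ℂ ⟨FreeAlgebra.lift ℂ fun s => gen q s ⊗ₜ single (weight m n s) 1, by
    have e1 := α_mul_β (q := q)
    have e2 := βStar_mul_αStar (q := q)
    have e3 := α_mul_βStar (q := q)
    have e4 := β_mul_αStar (q := q)
    have e5 := β_mul_βStar (q := q)
    have e6 := α_mul_αStar (q := q)
    have e7 := sphere (q := q)
    simp only [α, αStar, β, βStar] at e1 e2 e3 e4 e5 e6 e7
    intro x y h
    cases h <;>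
      simp only [map_mul, map_add, map_smul, map_one, FreeAlgebra.lift_ι_apply, weight,
        Algebra.TensorProduct.tmul_mul_tmul, single_mul_single, mul_one, add_neg_cancel,
        neg_add_cancel, ← TensorProduct.add_tmul, TensorProduct.smul_tmul', e7]
    · rw [e1, add_comm]
    · rw [e2, add_comm]
    · rw [e3, add_comm]
    · rw [e4, add_comm]
    · rw [e5]
    · rw [e6]
    · rfl⟩

open AddMonoidAlgebra in
lemma coactHom_gen {G : Type} [AddCommGroup G] (m n : G) (s : SUGen) :
    coactHom q m n (gen q s) = gen q s ⊗ₜ single (weight m n s) 1 := by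
  simp [coactHom, gen, RingQuot.liftAlgHom_mkAlgHom_apply]

/-- `O(SU_q(2))` as a right `ℂ[G]`-comodule algebra with `α ↦ α ⊗ m`, `β ↦ β ⊗ n`. -/
def comodule (q : ℝ) {G : Type} [AddCommGroup G] (m n : G) :
    ComoduleAlgebra ℂ (AddMonoidAlgebra ℂ G) (SUq q) where
  coact := coactHom q m n
  coassoc x := by
    let H := AddMonoidAlgebra ℂ G
    let f : SUq q →ₐ[ℂ] SUq q ⊗[ℂ] (H ⊗[ℂ] H) :=
      ((Algebra.TensorProduct.assoc ℂ ℂ ℂ (SUq q) H H).toAlgHom.comp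
        (Algebra.TensorProduct.map (coactHom q m n) (.id ℂ H))).comp (coactHom q m n)
    let g : SUq q →ₐ[ℂ] SUq q ⊗[ℂ] (H ⊗[ℂ] H) :=
      (Algebra.TensorProduct.map (.id ℂ (SUq q)) (Bialgebra.comulAlgHom ℂ H)).comp (coactHom q m n)
    have h : f = g := by
      apply algHom_ext
      intro s
      simp [f, g, H, coactHom_gen]
    exact DFunLike.congr_fun h x
  counital x := by
    let H := AddMonoidAlgebra ℂ G
    let f : SUq q →ₐ[ℂ] SUq q :=
      ((Algebra.TensorProduct.rid ℂ ℂ (SUq q)).toAlgHom.comp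
        (Algebra.TensorProduct.map (.id ℂ (SUq q)) (Bialgebra.counitAlgHom ℂ H))).comp
          (coactHom q m n)
    have h : f = .id ℂ _ := by
      apply algHom_ext
      intro s
      simp [f, H, coactHom_gen]
    exact DFunLike.congr_fun h x

end SUq

/-! ### Homogeneous components for a coaction of `ℂ[ℤ]` -/

section Components

open AddMonoidAlgebra

variable {A : Type*} [Ring A] [Algebra ℂ A] {G : Type}

/-- The component of an element of `A ⊗ ℂ[G]` at `n : G`. -/
def component (A : Type*) [Ring A] [Algebra ℂ A] {G : Type} (n : G) :
    A ⊗[ℂ] AddMonoidAlgebra ℂ G →ₗ[ℂ] A :=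
  (TensorProduct.rid ℂ A).toLinearMap ∘ₗ
    (Finsupp.lapply n ∘ₗ (coeffLinearEquiv ℂ).toLinearMap).lTensor A

lemma component_tmul (n : G) (a : A) (h : AddMonoidAlgebra ℂ G) :
    component A n (a ⊗ₜ h) = h.coeff n • a := by
  simp [component]

lemma exists_components (t : A ⊗[ℂ] AddMonoidAlgebra ℂ G) :
    ∃ S : Finset G, t = ∑ n ∈ S, component A n t ⊗ₜ[ℂ] single n (1 : ℂ) := by
  classical
  suffices h : ∃ f : G →₀ A, t = f.sum fun n a => a ⊗ₜ[ℂ] single n (1 : ℂ) by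
    obtain ⟨f, hf⟩ := h
    refine ⟨f.support, ?_⟩
    conv_lhs => rw [hf]
    refine Finset.sum_congr rfl fun n hn => ?_
    congr 1
    rw [hf, Finsupp.sum, map_sum]
    simp only [component_tmul, coeff_single, Finsupp.single_apply, ite_smul, one_smul, zero_smul]
    rw [Finset.sum_ite_eq', if_pos hn]
  induction t with
  | zero => exact ⟨0, by simp⟩
  | add x y hx hy =>
    obtain ⟨f, rfl⟩ := hx
    obtain ⟨g, rfl⟩ := hy
    refine ⟨f + g, ?_⟩
    rw [Finsupp.sum_add_index'] <;> simp [TensorProduct.add_tmul]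
  | tmul a h =>
    induction h using AddMonoidAlgebra.induction_linear with
    | zero => exact ⟨0, by simp⟩
    | add x y hx hy =>
      obtain ⟨f, hf⟩ := hx
      obtain ⟨g, hg⟩ := hy
      refine ⟨f + g, ?_⟩
      rw [TensorProduct.tmul_add, hf, hg, Finsupp.sum_add_index'] <;> simp [TensorProduct.add_tmul]
    | single n r =>
      refine ⟨Finsupp.single n (r • a), ?_⟩
      rw [Finsupp.sum_single_index (by simp), TensorProduct.smul_tmul, smul_single]
      simp

variable [AddCommGroup G]

lemma coact_component (ρ : ComoduleAlgebra ℂ (AddMonoidAlgebra ℂ G) A) (n : G) (x : A) :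
    ρ.coact (component A n (ρ.coact x)) = component A n (ρ.coact x) ⊗ₜ single n 1 := by
  classical
  let H := AddMonoidAlgebra ℂ G
  let P : A ⊗[ℂ] (H ⊗[ℂ] H) →ₗ[ℂ] A ⊗[ℂ] H := (component H n).lTensor A
  have h1 : ∀ t : A ⊗[ℂ] H, P (TensorProduct.assoc ℂ A H H (ρ.coact.toLinearMap.rTensor H t)) =
      ρ.coact (component A n t) := by
    intro t
    induction t with
    | zero => simp
    | add x y hx hy => simp only [map_add, hx, hy]
    | tmul a h =>
      rw [component_tmul, map_smul, LinearMap.rTensor_tmul]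
      change P (TensorProduct.assoc ℂ A H H (ρ.coact a ⊗ₜ h)) = _
      generalize ρ.coact a = s
      induction s with
      | zero => simp
      | add x y hx hy => simp only [TensorProduct.add_tmul, map_add, hx, hy, smul_add]
      | tmul b k =>
        rw [TensorProduct.assoc_tmul, LinearMap.lTensor_tmul, component_tmul]
        exact (TensorProduct.tmul_smul _ _ _)
  have h2 : ∀ t : A ⊗[ℂ] H, P ((Coalgebra.comul (R := ℂ) (A := H)).lTensor A t) =
      component A n t ⊗ₜ single n 1 := by
    intro t
    obtain ⟨S, hS⟩ := exists_components t
    have : ∀ (a : A) (m : G), P ((Coalgebra.comul (R := ℂ) (A := H)).lTensor A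
        (a ⊗ₜ single m 1)) = component A n (a ⊗ₜ single m 1) ⊗ₜ single n 1 := by
      intro a m
      by_cases hm : m = n
      · subst hm
        simp [P, H, component_tmul]
      · simp [P, H, component_tmul, hm]
    rw [hS]
    simp only [map_sum, TensorProduct.sum_tmul, this]
  rw [← h1, ρ.coassoc, h2]

lemma component_rTensor (ρ : ComoduleAlgebra ℂ (AddMonoidAlgebra ℂ G) A) (n : G) (x : A) :
    (component A n ∘ₗ ρ.coact.toLinearMap).rTensor _ (ρ.coact x) =
      component A n (ρ.coact x) ⊗ₜ[ℂ] single n (1 : ℂ) := by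
  classical
  obtain ⟨S, hS⟩ := exists_components (ρ.coact x)
  conv_lhs => rw [hS]
  simp only [map_sum, LinearMap.rTensor_tmul, LinearMap.comp_apply, AlgHom.toLinearMap_apply,
    coact_component, component_tmul, coeff_single, Finsupp.single_apply]
  by_cases hn : n ∈ S
  · rw [Finset.sum_eq_single n] <;> simp +contextual [hn]
  · rw [Finset.sum_eq_zero]
    · have : component A n (ρ.coact x) = 0 := by
        rw [hS, map_sum]
        refine Finset.sum_eq_zero fun m hm => ?_
        have : m ≠ n := by rintro rfl; exact hn hm
        simp [component_tmul, this]
      simp [this]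
    · intro m hm
      have : m ≠ n := by rintro rfl; exact hn hm
      simp [this]

lemma eq_sum_components (ρ : ComoduleAlgebra ℂ (AddMonoidAlgebra ℂ G) A) (x : A) :
    ∃ S : Finset G, x = ∑ n ∈ S, component A n (ρ.coact x) := by
  obtain ⟨S, hS⟩ := exists_components (ρ.coact x)
  refine ⟨S, ?_⟩
  have h := ρ.counital x
  rw [hS] at h
  simpa using h.symm

/-- An algebra map `f : A → A ⊗ ℂ[G]` is a coaction as soon as `A` is spanned by elements `y` with
`f y = y ⊗ m` for some `m : G`. -/
def ComoduleAlgebra.ofHomogeneous (f : A →ₐ[ℂ] A ⊗[ℂ] AddMonoidAlgebra ℂ G)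
    (hf : ∀ x, x ∈ Submodule.span ℂ {y : A | ∃ m : G, f y = y ⊗ₜ single m 1}) :
    ComoduleAlgebra ℂ (AddMonoidAlgebra ℂ G) A where
  coact := f
  coassoc x := by
    induction hf x using Submodule.span_induction with
    | mem y hy =>
      obtain ⟨m, hm⟩ := hy
      simp [hm]
    | zero => simp
    | add a b _ _ ha hb => simp only [map_add, ha, hb]
    | smul c a _ ha => simp only [map_smul, ha]
  counital x := by
    induction hf x using Submodule.span_induction with
    | mem y hy =>
      obtain ⟨m, hm⟩ := hy
      simp [hm]
    | zero => simp
    | add a b _ _ ha hb => simp only [map_add, ha, hb]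
    | smul c a _ ha => simp only [map_smul, ha]

end Components

/-! ### The coordinate algebra of the quantum lens space -/

/-- The coordinate algebra `O(L_q(l;1,l))`: the subalgebra of coinvariants of `O(SU_q(2))` for the
coaction `α ↦ α ⊗ w`, `β ↦ β ⊗ 1` of the group algebra `O(ℤ_l)` of the cyclic group of order `l`,
with generator `w` of order `l`. -/
abbrev Lens (q : ℝ) (l : ℕ) : Subalgebra ℂ (SUq q) :=
  (SUq.comodule q (1 : ZMod l) (0 : ZMod l)).coinvariants

namespace Lens

open AddMonoidAlgebra

variable {q : ℝ} {l : ℕ}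

lemma mem_iff (x : SUq q) :
    x ∈ Lens q l ↔ SUq.coactHom q (1 : ZMod l) (0 : ZMod l) x = x ⊗ₜ 1 := Iff.rfl

/-- The coaction `ϱ_{1,l} : O(SU_q(2)) → O(SU_q(2)) ⊗ ℂ[u,u*]`, with `α ↦ α ⊗ u` and
`β ↦ β ⊗ u⁻ˡ`. -/
abbrev weightedComodule (q : ℝ) (l : ℕ) : ComoduleAlgebra ℂ ℂ[T;T⁻¹] (SUq q) :=
  SUq.comodule q (1 : ℤ) (-(l : ℤ))

lemma cyclic_eq (x : SUq q) :
    SUq.coactHom q (1 : ZMod l) (0 : ZMod l) x =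
      (mapDomainAlgHom ℂ ℂ (Int.castAddHom (ZMod l))).toLinearMap.lTensor (SUq q)
        ((weightedComodule q l).coact x) := by
  have h : SUq.coactHom q (1 : ZMod l) (0 : ZMod l) =
      (Algebra.TensorProduct.map (.id ℂ (SUq q))
        (mapDomainAlgHom ℂ ℂ (Int.castAddHom (ZMod l)))).comp (weightedComodule q l).coact := by
    apply SUq.algHom_ext
    intro s
    cases s <;> simp [SUq.comodule, SUq.coactHom_gen, SUq.weight,
      -LaurentPolynomial.single_eq_C_mul_T]
  exact DFunLike.congr_fun h x

lemma component_aux {x : SUq q} (hx : x ∈ Lens q l) (n : ℤ) :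
    component (SUq q) n ((weightedComodule q l).coact x) ⊗ₜ[ℂ] single (n : ZMod l) (1 : ℂ) =
      component (SUq q) n ((weightedComodule q l).coact x) ⊗ₜ 1 := by
  have h := (mem_iff x).1 hx
  rw [cyclic_eq] at h
  have h' := congrArg ((component (SUq q) n ∘ₗ
    (weightedComodule q l).coact.toLinearMap).rTensor _) h
  rw [← LinearMap.comp_apply, LinearMap.rTensor_comp_lTensor, ← LinearMap.lTensor_comp_rTensor,
    LinearMap.comp_apply, component_rTensor] at h'
  simpa [-LaurentPolynomial.single_eq_C_mul_T] using h'

lemma component_mem {x : SUq q} (hx : x ∈ Lens q l) (n : ℤ) :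
    component (SUq q) n ((weightedComodule q l).coact x) ∈ Lens q l := by
  rw [mem_iff, cyclic_eq, coact_component]
  simpa [-LaurentPolynomial.single_eq_C_mul_T] using component_aux hx n

lemma component_eq_zero {x : SUq q} (hx : x ∈ Lens q l) {n : ℤ} (hn : ¬ (l : ℤ) ∣ n) :
    component (SUq q) n ((weightedComodule q l).coact x) = 0 := by
  have h := congrArg (component (SUq q) (0 : ZMod l)) (component_aux hx n)
  have hn' : (n : ZMod l) ≠ 0 := by rwa [Ne, ZMod.intCast_zmod_eq_zero_iff_dvd]
  rw [component_tmul, component_tmul] at h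
  simpa [one_def, hn'] using h.symm

/-- Every element of `O(L_q(l;1,l))` is a sum of homogeneous ones, of degrees divisible by `l`. -/
lemma mem_span (x : Lens q l) :
    x ∈ Submodule.span ℂ {y : Lens q l | ∃ m : ℤ,
      (weightedComodule q l).coact y = (y : SUq q) ⊗ₜ single (l * m) 1} := by
  obtain ⟨S, hS⟩ := eq_sum_components (weightedComodule q l) x
  have : x = ∑ n ∈ S, (⟨_, component_mem x.2 n⟩ : Lens q l) := by
    apply Subtype.ext
    rw [AddSubmonoidClass.coe_finsetSum]
    exact hS
  rw [this]
  refine Submodule.sum_mem _ fun n _ => ?_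
  by_cases hn : (l : ℤ) ∣ n
  · obtain ⟨m, rfl⟩ := hn
    exact Submodule.subset_span ⟨m, coact_component _ _ _⟩
  · have : (⟨_, component_mem x.2 n⟩ : Lens q l) = 0 := Subtype.ext (component_eq_zero x.2 hn)
    rw [this]
    exact Submodule.zero_mem _

/-- The algebra map `(-)^l : ℂ[u,u*] → ℂ[u,u*]`, `u ↦ u^l`. -/
def powMap (l : ℕ) : ℂ[T;T⁻¹] →ₐ[ℂ] ℂ[T;T⁻¹] :=
  mapDomainAlgHom ℂ ℂ (AddMonoidHom.mulLeft (l : ℤ))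

lemma powMap_single (m : ℤ) : powMap l (single m 1) = single (l * m) 1 := by
  simp [powMap, -LaurentPolynomial.single_eq_C_mul_T]

lemma powMap_injective (hl : 0 < l) : Function.Injective (powMap l) := by
  have h : Function.Injective (AddMonoidHom.mulLeft (l : ℤ)) := fun a b hab =>
    mul_left_cancel₀ (by exact_mod_cast hl.ne') hab
  exact mapDomain_injective h

/-- The map `ι ⊗ (-)^l`, where `ι` is the inclusion `O(L_q(l;1,l)) → O(SU_q(2))`. -/
def inclTensorPow (q : ℝ) (l : ℕ) :
    Lens q l ⊗[ℂ] ℂ[T;T⁻¹] →ₐ[ℂ] SUq q ⊗[ℂ] ℂ[T;T⁻¹] :=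
  Algebra.TensorProduct.map (Lens q l).val (powMap l)

lemma inclTensorPow_injective (hl : 0 < l) : Function.Injective (inclTensorPow q l) :=
  TensorProduct.map_injective_of_flat_flat _ _ Subtype.val_injective (powMap_injective hl)

lemma coact_mem_range (x : Lens q l) :
    (weightedComodule q l).coact x ∈ (inclTensorPow q l).range := by
  induction mem_span x using Submodule.span_induction with
  | mem y hy =>
    obtain ⟨m, hm⟩ := hy
    exact ⟨y ⊗ₜ single m 1, by rw [hm]; simp [inclTensorPow, powMap_single, -LaurentPolynomial.single_eq_C_mul_T]⟩
  | zero => simp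
  | add a b _ _ ha hb => simpa using add_mem ha hb
  | smul c a _ ha => simpa using Subalgebra.smul_mem _ ha c

/-- The coaction `ϱ_l` on `O(L_q(l;1,l))`, as an algebra map. It is the unique map with
`(ι ⊗ (-)^l) ∘ ϱ_l = ϱ_{1,l} ∘ ι`. -/
def coactHom (q : ℝ) {l : ℕ} (hl : 0 < l) : Lens q l →ₐ[ℂ] Lens q l ⊗[ℂ] ℂ[T;T⁻¹] :=
  (AlgEquiv.ofInjective (inclTensorPow q l) (inclTensorPow_injective hl)).symm.toAlgHom.comp
    (((weightedComodule q l).coact.comp (Lens q l).val).codRestrict _ coact_mem_range)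

lemma inclTensorPow_coactHom (hl : 0 < l) (x : Lens q l) :
    inclTensorPow q l (coactHom q hl x) = (weightedComodule q l).coact x := by
  have h := (AlgEquiv.ofInjective (inclTensorPow q l) (inclTensorPow_injective hl)).apply_symm_apply
    (((weightedComodule q l).coact.comp (Lens q l).val).codRestrict _ coact_mem_range x)
  exact congrArg Subtype.val h

lemma coactHom_eq (hl : 0 < l) {x : Lens q l} {m : ℤ}
    (h : (weightedComodule q l).coact x = (x : SUq q) ⊗ₜ single (l * m) 1) :
    coactHom q hl x = x ⊗ₜ single m 1 := by
  apply inclTensorPow_injective hl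
  rw [inclTensorPow_coactHom, h]
  simp [inclTensorPow, powMap_single, -LaurentPolynomial.single_eq_C_mul_T]

/-- `O(L_q(l;1,l))` as a right comodule algebra over `O(U(1)) = ℂ[u,u*]`, where `u = T 1` and
`u* = u⁻¹ = T (-1)`; the coaction is `c ↦ c ⊗ u`, `d ↦ d ⊗ u*` for `c = αˡ`, `d = β`. -/
def comodule (q : ℝ) {l : ℕ} (hl : 0 < l) : ComoduleAlgebra ℂ ℂ[T;T⁻¹] (Lens q l) :=
  ComoduleAlgebra.ofHomogeneous (coactHom q hl) fun x => by
    refine Submodule.span_mono ?_ (mem_span x)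
    rintro y ⟨m, hm⟩
    exact ⟨m, coactHom_eq hl hm⟩

/-- The element `c = αˡ`. -/
def c (q : ℝ) (l : ℕ) : Lens q l :=
  ⟨SUq.α q ^ l, by
    rw [mem_iff, map_pow, SUq.α, SUq.coactHom_gen]
    simp [SUq.weight, single_pow, one_def]⟩

/-- The element `c* = α*ˡ`. -/
def cStar (q : ℝ) (l : ℕ) : Lens q l :=
  ⟨SUq.αStar q ^ l, by
    rw [mem_iff, map_pow, SUq.αStar, SUq.coactHom_gen]
    simp [SUq.weight, single_pow, one_def]⟩

/-- The element `d = β`. -/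
def d (q : ℝ) (l : ℕ) : Lens q l :=
  ⟨SUq.β q, by
    rw [mem_iff, SUq.β, SUq.coactHom_gen]
    simp [SUq.weight, one_def]⟩

/-- The element `d* = β*`. -/
def dStar (q : ℝ) (l : ℕ) : Lens q l :=
  ⟨SUq.βStar q, by
    rw [mem_iff, SUq.βStar, SUq.coactHom_gen]
    simp [SUq.weight, one_def]⟩

lemma coact_c (hl : 0 < l) :
    (comodule q hl).coact (c q l) = c q l ⊗ₜ LaurentPolynomial.T 1 := by
  refine coactHom_eq hl (m := 1) ?_
  simp [c, SUq.comodule, SUq.α, SUq.coactHom_gen, SUq.weight]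

lemma coact_cStar (hl : 0 < l) :
    (comodule q hl).coact (cStar q l) = cStar q l ⊗ₜ LaurentPolynomial.T (-1) := by
  refine coactHom_eq hl (m := -1) ?_
  simp [cStar, SUq.comodule, SUq.αStar, SUq.coactHom_gen, SUq.weight]

lemma coact_d (hl : 0 < l) :
    (comodule q hl).coact (d q l) = d q l ⊗ₜ LaurentPolynomial.T (-1) := by
  refine coactHom_eq hl (m := -1) ?_
  simp [d, SUq.comodule, SUq.β, SUq.coactHom_gen, SUq.weight]

lemma coact_dStar (hl : 0 < l) :
    (comodule q hl).coact (dStar q l) = dStar q l ⊗ₜ LaurentPolynomial.T 1 := by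
  refine coactHom_eq hl (m := 1) ?_
  simp [dStar, SUq.comodule, SUq.βStar, SUq.coactHom_gen, SUq.weight]

end Lens

end QuantumLens

end

open scoped TensorProduct LaurentPolynomial

noncomputable section

/-! ### Units of skew group algebras -/

namespace SkewMonoidAlgebra

variable {k G : Type*} [CommRing k] [Group G] [MulSemiringAction G k]

/-! Both claims come down to one fact: $\mathcal O(SU_q(2))$ has only scalar units. It is realised
inside the skew Laurent algebra $\mathbb C[x,y][a^{\pm1}]$ with $ax=qxa$, $ay=qya$, by $\beta\mapsto
x$, $\beta^*\mapsto y$, $\alpha\mapsto a$, $\alpha^*\mapsto(1-q^{-2}xy)a^{-1}$ (`toSkew`). Every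
element of $\mathcal O(SU_q(2))$ has the form $\sum_n p_n(\beta,\beta^*)\alpha^n$, with
$\alpha^{*|n|}$ for $n<0$ (`normalForm_surjective`), and the images of the $\alpha^n$ sit in
distinct degrees with nonzero coefficients, so the map is injective (`toSkew_injective`).

Since $\mathbb C[x,y]$ is a domain and $\mathbb Z$ has two unique products, a unit of the skew
Laurent algebra is a monomial $r a^n$ with $r$ a unit (`exists_single_of_mul_eq_one`). In the image
of $\mathcal O(SU_q(2))$ a coefficient of negative degree is divisible by the nonunit $1-q^{-2}xy$,
so a unit and its inverse both have degree $\ge 0$ (`nonneg_of_toSkew_eq_single`). Their degrees add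
up to $0$, hence both vanish, and the unit is an invertible polynomial, that is, a scalar.

A unit of the lens algebra is a unit of $\mathcal O(SU_q(2))$, hence scalar. A cleaving map would
send the grouplike $u$ to a unit, thus to a nonzero scalar; this is coinvariant, whereas colinearity
puts it in degree $1$. -/

lemma coeff_mul_of_uniqueMul {f g : SkewMonoidAlgebra k G} {a b : G}
    (h : UniqueMul f.support g.support a b) :
    (f * g).coeff (a * b) = f.coeff a * a • g.coeff b := by
  classical
  rw [coeff_mul]
  change ∑ x ∈ f.support, ∑ y ∈ g.support, _ = _
  rw [Finset.sum_eq_single a, Finset.sum_eq_single b]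
  · exact if_pos rfl
  · intro y _ hy
    exact if_neg fun e => hy (mul_left_cancel e)
  · intro hb
    refine (if_pos rfl).trans ?_
    change _ * a • g.coeff b = 0
    rw [notMem_support_iff.1 hb, smul_zero, mul_zero]
  · intro x hx hxa
    refine Finset.sum_eq_zero fun y hy => if_neg fun e => hxa (h hx hy e).1
  · intro ha
    refine Finset.sum_eq_zero fun y _ => ?_
    change (if _ then f.coeff a * _ else 0) = _
    rw [notMem_support_iff.1 ha, zero_mul, ite_self]

variable [IsDomain k]

/-- A group element acts injectively, so twisting the second factor keeps it nonzero, and a domain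
has no zero divisors. -/
lemma coeff_mul_ne_zero_of_uniqueMul {f g : SkewMonoidAlgebra k G} {a b : G}
    (ha : a ∈ f.support) (hb : b ∈ g.support) (h : UniqueMul f.support g.support a b) :
    (f * g).coeff (a * b) ≠ 0 := by
  rw [coeff_mul_of_uniqueMul h]
  exact mul_ne_zero (mem_support_iff.1 ha) ((smul_ne_zero_iff_ne a).2 (mem_support_iff.1 hb))

/-- A unit of the skew group algebra of a group with two unique products over a domain is
homogeneous. -/
lemma exists_single_of_mul_eq_one [TwoUniqueProds G] {f g : SkewMonoidAlgebra k G}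
    (h : f * g = 1) : ∃ a b r s, f = single a r ∧ g = single b s ∧ a * b = 1 ∧ r * a • s = 1 := by
  classical
  have hf : f.support.card ≠ 0 := by
    rw [Finset.card_ne_zero, Finset.nonempty_iff_ne_empty, Ne, support_eq_empty]
    rintro rfl
    simp at h
  have hg : g.support.card ≠ 0 := by
    rw [Finset.card_ne_zero, Finset.nonempty_iff_ne_empty, Ne, support_eq_empty]
    rintro rfl
    simp at h
  -- Two distinct unique products would give two nonzero coefficients of `f * g = 1`. Both would lie
  -- at the identity, and uniqueness would make the two pairs equal.
  have hle : ¬ 1 < f.support.card * g.support.card := by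
    intro hlt
    obtain ⟨p, hp, p', hp', hne, hu, hu'⟩ := TwoUniqueProds.uniqueMul_of_one_lt_card hlt
    rw [Finset.mem_product] at hp hp'
    have key : ∀ c : G, (f * g).coeff c ≠ 0 → c = 1 := by
      intro c hc
      by_contra hc1
      rw [h, coeff_one, Finsupp.single_eq_of_ne hc1] at hc
      exact hc rfl
    have e := key _ (coeff_mul_ne_zero_of_uniqueMul hp.1 hp.2 hu)
    have e' := key _ (coeff_mul_ne_zero_of_uniqueMul hp'.1 hp'.2 hu')
    have := hu hp'.1 hp'.2 (e'.trans e.symm)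
    exact hne (Prod.ext this.1.symm this.2.symm)
  have hf1 : f.support.card = 1 := by
    have := Nat.le_mul_of_pos_right f.support.card (Nat.pos_of_ne_zero hg)
    omega
  have hg1 : g.support.card = 1 := by
    have := Nat.le_mul_of_pos_left g.support.card (Nat.pos_of_ne_zero hf)
    omega
  have single_of_card : ∀ u : SkewMonoidAlgebra k G, u.support.card = 1 →
      ∃ a r, u = single a r := by
    intro u hu
    obtain ⟨a, r, -, e⟩ := Finsupp.card_support_eq_one'.1 (show u.coeff.support.card = 1 from hu)
    exact ⟨a, r, coeff_injective e⟩
  obtain ⟨a, r, rfl⟩ := single_of_card f hf1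
  obtain ⟨b, s, rfl⟩ := single_of_card g hg1
  rw [single_mul_single] at h
  have hab : a * b = 1 := by
    by_contra hab
    have := congrArg (fun u => u.coeff 1) h
    simp [hab] at this
  refine ⟨a, b, r, s, rfl, rfl, hab, ?_⟩
  rw [hab, one_def] at h
  exact single_injective _ h

end SkewMonoidAlgebra

namespace QuantumLens

/-! ### The skew Laurent polynomial algebra over the polynomial ring in two variables -/

open MvPolynomial in
/-- The endomorphism of a polynomial ring multiplying all variables by `t`. -/
def scale (t : ℂ) : MvPolynomial Bool ℂ →ₐ[ℂ] MvPolynomial Bool ℂ :=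
  aeval fun i => C t * X i

@[simp]
lemma scale_X (t : ℂ) (i : Bool) :
    scale t (MvPolynomial.X i) = MvPolynomial.C t * MvPolynomial.X i := by
  simp [scale]

@[simp]
lemma scale_C (t z : ℂ) : scale t (MvPolynomial.C z) = MvPolynomial.C z := by
  simp [scale]

lemma scale_comp_scale {s t : ℂ} (h : s * t = 1) : (scale s).comp (scale t) = .id ℂ _ := by
  apply MvPolynomial.algHom_ext
  intro i
  simp only [AlgHom.comp_apply, scale_X, map_mul, scale_C, AlgHom.id_apply]
  rw [← mul_assoc, ← map_mul, mul_comm t, h, map_one, one_mul]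

/-- The automorphism of a polynomial ring multiplying all variables by the unit `t`. -/
def scaleEquiv (t : ℂˣ) : MvPolynomial Bool ℂ ≃ₐ[ℂ] MvPolynomial Bool ℂ :=
  .ofAlgHom (scale t) (scale ↑t⁻¹) (scale_comp_scale (by simp)) (scale_comp_scale (by simp))

/-- The polynomial ring in two variables, on which the infinite cyclic group acts by multiplying
the variables by powers of `t`. -/
def ScaledPoly (_ : ℂˣ) : Type := MvPolynomial Bool ℂ

namespace ScaledPoly

variable {t : ℂˣ}

instance : CommRing (ScaledPoly t) := inferInstanceAs (CommRing (MvPolynomial Bool ℂ))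
instance : IsDomain (ScaledPoly t) := inferInstanceAs (IsDomain (MvPolynomial Bool ℂ))
instance : Algebra ℂ (ScaledPoly t) := inferInstanceAs (Algebra ℂ (MvPolynomial Bool ℂ))

/-- The identification with the polynomial ring. -/
def equiv (t : ℂˣ) : MvPolynomial Bool ℂ ≃ₐ[ℂ] ScaledPoly t := AlgEquiv.refl

/-- The variables. -/
def var (t : ℂˣ) (i : Bool) : ScaledPoly t := equiv t (MvPolynomial.X i)

/-- The automorphism multiplying the variables by `t`. -/
def autom (t : ℂˣ) : ScaledPoly t ≃ₐ[ℂ] ScaledPoly t :=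
  ((equiv t).symm.trans (scaleEquiv t)).trans (equiv t)

lemma autom_var (i : Bool) : autom t (var t i) = (t : ℂ) • var t i := by
  exact (scale_X _ i).trans (MvPolynomial.smul_eq_C_mul _ _).symm

lemma autom_symm_var (i : Bool) : (autom t).symm (var t i) = (↑t⁻¹ : ℂ) • var t i := by
  rw [AlgEquiv.symm_apply_eq, map_smul, autom_var, smul_smul]
  simp

@[elab_as_elim]
lemma induction {P : ScaledPoly t → Prop} (h1 : ∀ z, P (algebraMap ℂ _ z))
    (hadd : ∀ p r, P p → P r → P (p + r)) (hmul : ∀ p i, P p → P (p * var t i))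
    (p : ScaledPoly t) : P p :=
  MvPolynomial.induction_on (motive := P) p h1 hadd hmul

/-- Carrying `t` in the type lets the action, which depends on `t`, be an instance. -/
instance : MulSemiringAction (Multiplicative ℤ) (ScaledPoly t) :=
  MulSemiringAction.compHom _ (zpowersHom (ScaledPoly t ≃ₐ[ℂ] ScaledPoly t) (autom t))

lemma smul_def (n : ℤ) (p : ScaledPoly t) : Multiplicative.ofAdd n • p = (autom t ^ n) p := rfl

instance : SMulCommClass (Multiplicative ℤ) ℂ (ScaledPoly t) where
  smul_comm n z p := map_smul (autom t ^ n.toAdd) z p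

lemma one_smul_var (i : Bool) :
    Multiplicative.ofAdd (1 : ℤ) • var t i = (t : ℂ) • var t i := by
  rw [smul_def, zpow_one, autom_var]

lemma neg_one_smul_var (i : Bool) :
    Multiplicative.ofAdd (-1 : ℤ) • var t i = (↑t⁻¹ : ℂ) • var t i := by
  rw [smul_def, zpow_neg_one]
  exact autom_symm_var i

lemma exists_of_isUnit {p : ScaledPoly t} (hp : IsUnit p) : ∃ z : ℂ, p = algebraMap ℂ _ z := by
  obtain ⟨z, -, hz⟩ := MvPolynomial.isUnit_iff_eq_C_of_isReduced.1
    (show IsUnit (M := MvPolynomial Bool ℂ) p from hp)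
  exact ⟨z, hz⟩

/-- The evaluation of polynomials at the point `(s, s)`. -/
def diagEval (t : ℂˣ) (s : ℂ) : ScaledPoly t →ₐ[ℂ] ℂ :=
  (MvPolynomial.aeval fun _ => s).comp (equiv t).symm.toAlgHom

lemma diagEval_var (s : ℂ) (i : Bool) : diagEval t s (var t i) = s :=
  MvPolynomial.aeval_X _ _

lemma one_sub_smul_ne_zero (z : ℂ) : 1 - z • (var t true * var t false) ≠ 0 := by
  intro h
  have := congrArg (diagEval t 0) h
  simp [diagEval_var] at this

/-- Units are constants, but this polynomial takes the values $1$ at $(0,0)$ and $1-z$ at $(1,1)$.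
-/
lemma not_isUnit_one_sub_smul {z : ℂ} (hz : z ≠ 0) :
    ¬ IsUnit (1 - z • (var t true * var t false)) := by
  intro h
  obtain ⟨w, hw⟩ := exists_of_isUnit h
  have h0 := congrArg (diagEval t 0) hw
  have h1 := congrArg (diagEval t 1) hw
  simp only [map_sub, map_smul, map_mul, diagEval_var, map_one, AlgHom.commutes] at h0 h1
  simp at h0 h1
  rw [← h0] at h1
  simp [hz] at h1

end ScaledPoly

end QuantumLens

/-! ### The skew Laurent model of $\mathcal O(SU_q(2))$. -/

namespace QuantumLens

open SkewMonoidAlgebra Multiplicative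

/-- The skew Laurent polynomial algebra in an invertible variable `a` over `ℂ[x,y]`, with
`a x = t x a` and `a y = t y a`. -/
abbrev SkewLaurent (t : ℂˣ) : Type := SkewMonoidAlgebra (ScaledPoly t) (Multiplicative ℤ)

namespace SUq

variable {q : ℝ} {t : ℂˣ}

open ScaledPoly

/-- The image of `α* α` in the commutative subalgebra generated by `β` and `β*`. -/
def aStarCoeff (t : ℂˣ) : ScaledPoly t := 1 - ((t : ℂ) ^ 2)⁻¹ • (var t true * var t false)

lemma one_smul_aStarCoeff :
    ofAdd (1 : ℤ) • aStarCoeff t = 1 - var t true * var t false := by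
  rw [aStarCoeff, smul_sub, smul_one, smul_comm, smul_mul', one_smul_var, one_smul_var,
    smul_mul_smul_comm, smul_smul, ← pow_two, inv_mul_cancel₀ (by simp), one_smul]

/-- The image of a generator in the skew Laurent polynomial algebra. -/
def genImage (t : ℂˣ) : SUGen → SkewLaurent t
  | .a => single (ofAdd 1) 1
  -- The relation $\alpha\alpha^*=1-\beta\beta^*$ forces $\alpha^*\mapsto a^{-1}(1-xy)$; moving
  -- $a^{-1}$ to the right rescales $xy$ by $t^{-2}$.
  | .aStar => single (ofAdd (-1)) (aStarCoeff t)
  | .b => single 1 (var t true)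
  | .bStar => single 1 (var t false)

/-- The embedding of `O(SU_q(2))` into a skew Laurent polynomial algebra. -/
def toSkew (ht : (t : ℂ) = q) : SUq q →ₐ[ℂ] SkewLaurent t :=
  RingQuot.liftAlgHom ℂ ⟨FreeAlgebra.lift ℂ (genImage t), by
    have e : ofAdd (1 : ℤ) * ofAdd (-1) = 1 := rfl
    have e' : ofAdd (-1 : ℤ) * ofAdd 1 = 1 := rfl
    intro x y h
    cases h <;>
      simp only [map_mul, map_add, map_smul, map_one, FreeAlgebra.lift_ι_apply, genImage,
        single_mul_single, mul_one, one_mul, e, e', one_smul, smul_one, one_smul_var,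
        neg_one_smul_var, one_smul_aStarCoeff, smul_single, ← single_add, one_def,
        ← ht]
    · rw [mul_smul_comm, smul_smul, Units.mul_inv, one_smul, mul_comm]
    · rw [mul_smul_comm, smul_smul, Units.mul_inv, one_smul, mul_comm]
    · rw [mul_comm]
    · rw [aStarCoeff, sub_smul, one_smul, sub_add_sub_cancel]
    · rw [sub_add_cancel]⟩

lemma toSkew_gen (ht : (t : ℂ) = q) (s : SUGen) : toSkew ht (gen q s) = genImage t s := by
  simp [toSkew, gen, RingQuot.liftAlgHom_mkAlgHom_apply]

/-! ### Normal form of elements and injectivity of the embedding. -/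

lemma induction_gen {P : SUq q → Prop} (h1 : ∀ z, P (algebraMap ℂ _ z)) (hgen : ∀ s, P (gen q s))
    (hmul : ∀ x y, P x → P y → P (x * y)) (hadd : ∀ x y, P x → P y → P (x + y)) (x : SUq q) :
    P x := by
  obtain ⟨f, rfl⟩ := RingQuot.mkAlgHom_surjective ℂ (SURel q) x
  induction f using FreeAlgebra.induction with
  | grade0 z => simpa using h1 z
  | grade1 s => exact hgen s
  | mul a b ha hb => simpa using hmul _ _ ha hb
  | add a b ha hb => simpa using hadd _ _ ha hb

/-- The commutative subalgebra generated by `β` and `β*`. -/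
abbrev betaSubalgebra (q : ℝ) : Subalgebra ℂ (SUq q) := Algebra.adjoin ℂ {β q, βStar q}

lemma betaSubalgebra_comm (x y : betaSubalgebra q) : x * y = y * x := by
  refine (Algebra.isMulCommutative_adjoin ℂ (s := {β q, βStar q}) ?_).is_comm.comm x y
  rintro a (rfl | rfl) b (rfl | rfl)
  exacts [rfl, β_mul_βStar, β_mul_βStar.symm, rfl]

/-- Polynomial evaluation needs a commutative target, so `betaEval` passes through this subalgebra.
-/
instance : CommRing (betaSubalgebra q) where
  mul_comm := betaSubalgebra_comm

/-- Evaluation of polynomials at `β` and `β*`. -/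
def betaEval (t : ℂˣ) (q : ℝ) : ScaledPoly t →ₐ[ℂ] SUq q :=
  ((betaSubalgebra q).val.comp (MvPolynomial.aeval (R := ℂ) fun i : Bool =>
    (⟨if i then β q else βStar q, Algebra.subset_adjoin (by cases i <;> simp)⟩ :
      betaSubalgebra q))).comp (equiv t).symm.toAlgHom

lemma betaEval_var_true : betaEval t q (var t true) = β q := by
  simp [betaEval, var]

lemma betaEval_var_false : betaEval t q (var t false) = βStar q := by
  simp [betaEval, var]

lemma toSkew_betaEval (ht : (t : ℂ) = q) (p : ScaledPoly t) :
    toSkew ht (betaEval t q p) = single 1 p := by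
  induction p using ScaledPoly.induction with
  | h1 z =>
    rw [AlgHom.commutes, AlgHom.commutes, Algebra.algebraMap_eq_smul_one,
      Algebra.algebraMap_eq_smul_one, one_def, smul_single]
  | hadd p r hp hr => rw [map_add, map_add, hp, hr, single_add]
  | hmul p i hp =>
    rw [map_mul, map_mul, hp]
    have : toSkew ht (betaEval t q (var t i)) = single 1 (var t i) := by
      cases i
      · rw [betaEval_var_false, βStar, toSkew_gen]; rfl
      · rw [betaEval_var_true, β, toSkew_gen]; rfl
    rw [this, single_mul_single, one_smul, one_mul]

lemma α_mul_betaEval (ht : (t : ℂ) = q) (p : ScaledPoly t) :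
    α q * betaEval t q p = betaEval t q (autom t p) * α q := by
  induction p using ScaledPoly.induction with
  | h1 z => rw [AlgEquiv.commutes, AlgHom.commutes, Algebra.commutes]
  | hadd p r hp hr => rw [map_add, map_add, map_add, mul_add, add_mul, hp, hr]
  | hmul p i hp =>
    have : α q * betaEval t q (var t i) = betaEval t q (autom t (var t i)) * α q := by
      rw [autom_var, map_smul, ht, smul_mul_assoc]
      cases i
      · rw [betaEval_var_false, α_mul_βStar]
      · rw [betaEval_var_true, α_mul_β]
    rw [map_mul, map_mul, map_mul, ← mul_assoc, hp, mul_assoc, this, mul_assoc]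

lemma betaEval_mul_αStar (ht : (t : ℂ) = q) (p : ScaledPoly t) :
    betaEval t q p * αStar q = αStar q * betaEval t q (autom t p) := by
  induction p using ScaledPoly.induction with
  | h1 z => rw [AlgEquiv.commutes, AlgHom.commutes, Algebra.commutes]
  | hadd p r hp hr => rw [map_add, map_add, map_add, mul_add, add_mul, hp, hr]
  | hmul p i hp =>
    have : betaEval t q (var t i) * αStar q = αStar q * betaEval t q (autom t (var t i)) := by
      rw [autom_var, map_smul, ht, mul_smul_comm]
      cases i
      · rw [betaEval_var_false, βStar_mul_αStar]
      · rw [betaEval_var_true, β_mul_αStar]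
    rw [map_mul, map_mul, map_mul, mul_assoc, this, ← mul_assoc, hp, mul_assoc]

lemma αStar_mul_betaEval (ht : (t : ℂ) = q) (p : ScaledPoly t) :
    αStar q * betaEval t q p = betaEval t q ((autom t).symm p) * αStar q := by
  rw [betaEval_mul_αStar ht, AlgEquiv.apply_symm_apply]

lemma α_mul_αStar_eq_betaEval :
    α q * αStar q = betaEval t q (1 - var t true * var t false) := by
  rw [map_sub, map_mul, map_one, betaEval_var_true, betaEval_var_false, ← sphere (q := q),
    add_sub_cancel_right]

/-- Eliminating $\alpha\alpha^*$ between the last two defining relations leaves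
$\alpha^*\alpha=1-q^{-2}\beta\beta^*$. -/
lemma αStar_mul_α_eq_betaEval (ht : (t : ℂ) = q) :
    αStar q * α q = betaEval t q (aStarCoeff t) := by
  have h : αStar q * α q = α q * αStar q - (((q : ℂ) ^ 2)⁻¹ - 1) • (β q * βStar q) :=
    (eq_sub_of_add_eq α_mul_αStar.symm)
  rw [h, ← add_sub_cancel_right (α q * αStar q) (β q * βStar q), sphere, aStarCoeff, map_sub,
    map_smul, map_mul, map_one, betaEval_var_true, betaEval_var_false, ht]
  have e : (((q : ℂ) ^ 2)⁻¹ - 1) • (β q * βStar q) =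
    ((q : ℂ) ^ 2)⁻¹ • (β q * βStar q) - (1 : ℂ) • (β q * βStar q) :=
    sub_smul (R := ℂ) (M := SUq q) _ _ _
  rw [e, one_smul]
  abel

/-- The element `αⁿ` for `n ≥ 0`, and `α*⁻ⁿ` for `n < 0`. -/
def alphaPow (q : ℝ) : ℤ → SUq q
  | .ofNat n => α q ^ n
  | .negSucc n => αStar q ^ (n + 1)

/-- For $n\ge0$ the coefficient is $1$; for $n<0$ it is a product of $|n|$ translates of `aStarCoeff
t`, the first of them untranslated. Nonvanishing serves injectivity, divisibility serves the degree
bound on units. -/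
lemma exists_toSkew_alphaPow (ht : (t : ℂ) = q) (n : ℤ) : ∃ r : ScaledPoly t, r ≠ 0 ∧
    toSkew ht (alphaPow q n) = single (ofAdd n) r ∧ (n < 0 → aStarCoeff t ∣ r) := by
  have hne : aStarCoeff t ≠ 0 := one_sub_smul_ne_zero _
  cases n with
  | ofNat n =>
    refine ⟨1, one_ne_zero, ?_, fun h => absurd h (by simp)⟩
    rw [alphaPow, α, map_pow, toSkew_gen, genImage]
    induction n with
    | zero => rfl
    | succ n ih => rw [pow_succ', ih, single_mul_single, smul_one, mul_one, ← ofAdd_add,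
        add_comm]; rfl
  | negSucc n =>
    rw [alphaPow, αStar, map_pow, toSkew_gen, genImage]
    induction n with
    | zero => exact ⟨aStarCoeff t, hne, by rw [zero_add, pow_one]; rfl, fun _ => dvd_rfl⟩
    | succ n ih =>
      obtain ⟨r, hr, hp, -⟩ := ih
      refine ⟨aStarCoeff t * ofAdd (-1 : ℤ) • r, mul_ne_zero hne ((smul_ne_zero_iff_ne _).2 hr),
        ?_, fun _ => dvd_mul_right _ _⟩
      rw [pow_succ', hp, single_mul_single, ← ofAdd_add]
      congr 2
      omega

/-- The linear map `(pₙ) ↦ ∑ₙ pₙ(β, β*) αⁿ`, where `αⁿ` means `α*⁻ⁿ` for `n < 0`. -/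
def normalForm (t : ℂˣ) (q : ℝ) : (ℤ →₀ ScaledPoly t) →ₗ[ℂ] SUq q :=
  Finsupp.lsum ℂ fun n => LinearMap.mulRight ℂ (alphaPow q n) ∘ₗ (betaEval t q).toLinearMap

lemma normalForm_single (n : ℤ) (p : ScaledPoly t) :
    normalForm t q (Finsupp.single n p) = betaEval t q p * alphaPow q n := by
  simp [normalForm]

lemma betaEval_mul_alphaPow_mem (p : ScaledPoly t) (n : ℤ) :
    betaEval t q p * alphaPow q n ∈ LinearMap.range (normalForm t q) :=
  ⟨_, normalForm_single n p⟩

/-- Once $\alpha$ or $\alpha^*$ is moved past the polynomial, it either lengthens the power or meets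
its adjoint, and the resulting $\alpha\alpha^*$ or $\alpha^*\alpha$ is again a polynomial in
$\beta,\beta^*$. -/
lemma gen_mul_mem (ht : (t : ℂ) = q) (s : SUGen) (p : ScaledPoly t) (n : ℤ) :
    gen q s * (betaEval t q p * alphaPow q n) ∈ LinearMap.range (normalForm t q) := by
  cases s with
  | a =>
    change α q * _ ∈ _
    rw [← mul_assoc, α_mul_betaEval ht, mul_assoc]
    rcases n with n | n
    · have : α q * alphaPow q (.ofNat n) = alphaPow q (.ofNat (n + 1)) := (pow_succ' _ _).symm
      rw [this]
      exact betaEval_mul_alphaPow_mem _ _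
    -- `.negSucc n` is $-(n+1)$; at `n = 0` the remaining exponent is $0$, which falls under the
    -- other branch of `alphaPow`, hence the case split.
    · have : alphaPow q (.negSucc n) = αStar q * alphaPow q (-n) := by
        rcases n with _ | n
        · simp [alphaPow]
        · exact pow_succ' (αStar q) (n + 1)
      rw [this, ← mul_assoc (α q), α_mul_αStar_eq_betaEval (t := t), ← mul_assoc, ← map_mul]
      exact betaEval_mul_alphaPow_mem _ _
  | aStar =>
    change αStar q * _ ∈ _
    rw [← mul_assoc, αStar_mul_betaEval ht, mul_assoc]
    rcases n with (_ | n) | n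
    · have : αStar q * alphaPow q (.ofNat 0) = alphaPow q (.negSucc 0) := by
        simp [alphaPow]
      rw [this]
      exact betaEval_mul_alphaPow_mem _ _
    · have : alphaPow q (.ofNat (n + 1)) = α q * alphaPow q (.ofNat n) := pow_succ' _ _
      rw [this, ← mul_assoc (αStar q), αStar_mul_α_eq_betaEval ht, ← mul_assoc, ← map_mul]
      exact betaEval_mul_alphaPow_mem _ _
    · have : αStar q * alphaPow q (.negSucc n) = alphaPow q (.negSucc (n + 1)) :=
        (pow_succ' _ _).symm
      rw [this]
      exact betaEval_mul_alphaPow_mem _ _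
  | b =>
    change β q * _ ∈ _
    rw [← betaEval_var_true (t := t), ← mul_assoc, ← map_mul]
    exact betaEval_mul_alphaPow_mem _ _
  | bStar =>
    change βStar q * _ ∈ _
    rw [← betaEval_var_false (t := t), ← mul_assoc, ← map_mul]
    exact betaEval_mul_alphaPow_mem _ _

lemma normalForm_surjective (ht : (t : ℂ) = q) : Function.Surjective (normalForm t q) := by
  -- The range is a left ideal; since it contains $1$, it is everything.
  have key : ∀ x y : SUq q, y ∈ LinearMap.range (normalForm t q) →
      x * y ∈ LinearMap.range (normalForm t q) := by
    intro x
    induction x using induction_gen with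
    | h1 z =>
      intro y hy
      rw [← Algebra.smul_def]
      exact Submodule.smul_mem _ _ hy
    | hgen s =>
      rintro _ ⟨f, rfl⟩
      induction f using Finsupp.induction_linear with
      | zero => simp
      | add f g hf hg => rw [map_add, mul_add]; exact add_mem hf hg
      | single n p => rw [normalForm_single]; exact gen_mul_mem ht s p n
    | hmul x y hx hy => intro z hz; rw [mul_assoc]; exact hx _ (hy _ hz)
    | hadd x y hx hy => intro z hz; rw [add_mul]; exact add_mem (hx _ hz) (hy _ hz)
  intro x
  have h1 : (1 : SUq q) ∈ LinearMap.range (normalForm t q) :=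
    ⟨Finsupp.single 0 1, by rw [normalForm_single, map_one, one_mul]; exact pow_zero _⟩
  simpa using key x 1 h1

/-- The multiplier `r` depends on `n` alone, so in this basis the embedding is diagonal: $p_n$ is
recovered from degree $n$ by cancelling `r`. -/
lemma exists_coeff_toSkew_normalForm (ht : (t : ℂ) = q) (n : ℤ) : ∃ r : ScaledPoly t, r ≠ 0 ∧
    (n < 0 → aStarCoeff t ∣ r) ∧
    ∀ f, (toSkew ht (normalForm t q f)).coeff (ofAdd n) = f n * r := by
  obtain ⟨r, hr, hn, hd⟩ := exists_toSkew_alphaPow ht n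
  refine ⟨r, hr, hd, fun f => ?_⟩
  induction f using Finsupp.induction_linear with
  | zero => simp
  | add f g hf hg => simp only [map_add, coeff_add, Finsupp.add_apply, hf, hg, add_mul]
  | single m p =>
    rw [normalForm_single, map_mul, toSkew_betaEval]
    by_cases hm : m = n
    · subst hm
      simp [hn]
    · obtain ⟨r', -, hn', -⟩ := exists_toSkew_alphaPow ht m
      simp [hn', hm]

lemma toSkew_injective (ht : (t : ℂ) = q) : Function.Injective (toSkew ht) := by
  rw [injective_iff_map_eq_zero]
  intro x hx
  obtain ⟨f, rfl⟩ := normalForm_surjective ht x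
  have : f = 0 := by
    ext n
    obtain ⟨r, hr, -, h⟩ := exists_coeff_toSkew_normalForm ht n
    have := h f
    rw [hx, coeff_zero, Finsupp.zero_apply] at this
    exact (mul_eq_zero.1 this.symm).resolve_right hr
  rw [this, map_zero]

/-- In negative degree `r` would be a multiple of the nonunit `aStarCoeff t`. This is where the
image differs from the whole skew Laurent algebra, in which $a$ is invertible. -/
lemma nonneg_of_toSkew_eq_single (ht : (t : ℂ) = q) {x : SUq q} {n : ℤ} {r : ScaledPoly t}
    (hr : IsUnit r) (h : toSkew ht x = single (ofAdd n) r) : 0 ≤ n := by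
  by_contra! hn
  obtain ⟨f, rfl⟩ := normalForm_surjective ht x
  obtain ⟨s, -, hs, hf⟩ := exists_coeff_toSkew_normalForm ht n
  have := hf f
  rw [h, coeff_single, Finsupp.single_eq_same] at this
  exact not_isUnit_one_sub_smul (by simp)
    (isUnit_of_dvd_unit ((hs hn).trans (Dvd.intro_left _ this.symm)) hr)

/-- The units of `O(SU_q(2))` are scalars. -/
theorem eq_algebraMap_of_isUnit (hq : q ≠ 0) {x : SUq q} (hx : IsUnit x) :
    ∃ z : ℂ, x = algebraMap ℂ (SUq q) z := by
  let t : ℂˣ := Units.mk0 (q : ℂ) (by exact_mod_cast hq)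
  have ht : (t : ℂ) = q := rfl
  obtain ⟨y, hxy⟩ := hx.exists_right_inv
  obtain ⟨a, b, r, s, ha, hb, hab, hrs⟩ := exists_single_of_mul_eq_one
    (show toSkew ht x * toSkew ht y = 1 by rw [← map_mul, hxy, map_one])
  have hr : IsUnit r := .of_mul_eq_one _ hrs
  -- The equation $r\,(a\cdot s)=1$ only makes the translate of `s` a unit; acting by $a^{-1}$
  -- recovers `s`.
  have hs : IsUnit s := by
    have := IsUnit.of_mul_eq_one_right _ hrs
    have := this.map (MulSemiringAction.toRingHom (Multiplicative ℤ) (ScaledPoly t) a⁻¹)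
    simpa using this
  have ha0 : 0 ≤ a.toAdd := nonneg_of_toSkew_eq_single ht hr ha
  have hb0 : 0 ≤ b.toAdd := nonneg_of_toSkew_eq_single ht hs hb
  have hab0 : a.toAdd + b.toAdd = 0 := by rw [← toAdd_mul, hab, toAdd_one]
  have ha1 : a = 1 := toAdd.injective (by rw [toAdd_one]; omega)
  obtain ⟨z, rfl⟩ := exists_of_isUnit hr
  refine ⟨z, toSkew_injective ht ?_⟩
  rw [ha, ha1, AlgHom.commutes, Algebra.algebraMap_eq_smul_one, Algebra.algebraMap_eq_smul_one,
    one_def, smul_single]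

lemma nontrivial (hq : q ≠ 0) : Nontrivial (SUq q) :=
  (toSkew (t := Units.mk0 (q : ℂ) (by exact_mod_cast hq)) rfl).toRingHom.domain_nontrivial

end SUq

end QuantumLens

/-! ### Units of the lens algebra and failure of cleftness. -/

namespace QuantumLens

namespace Lens

variable {q : ℝ} {l : ℕ}

/-- The units of `O(L_q(l;1,l))` are the nonzero scalars. -/
theorem isUnit_iff (hq : q ≠ 0) (x : Lens q l) :
    IsUnit x ↔ ∃ z : ℂ, z ≠ 0 ∧ x = algebraMap ℂ (Lens q l) z := by
  have := SUq.nontrivial hq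
  constructor
  · intro hx
    obtain ⟨z, hz⟩ := SUq.eq_algebraMap_of_isUnit hq (hx.map (Lens q l).val)
    refine ⟨z, ?_, Subtype.ext hz⟩
    rintro rfl
    rw [map_zero] at hz
    exact (hx.map (Lens q l).val).ne_zero hz
  · rintro ⟨z, hz, rfl⟩
    exact hz.isUnit.map (algebraMap ℂ (Lens q l))

end Lens

namespace ComoduleAlgebra

variable {R H A : Type*} [CommRing R] [Ring H] [Bialgebra R H] [Ring A] [Algebra R A]

/-- A convolution invertible map takes grouplike elements to units. -/
lemma isUnit_apply_of_isGroupLikeElem {j : H →ₗ[R] A} (hj : IsUnit (WithConv.toConv j)) {g : H}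
    (hg : IsGroupLikeElem R g) : IsUnit (j g) := by
  obtain ⟨⟨_, k, h1, h2⟩, rfl⟩ := hj
  have h1' := congrArg (fun f : WithConv (H →ₗ[R] A) => f.ofConv g) h1
  have h2' := congrArg (fun f : WithConv (H →ₗ[R] A) => f.ofConv g) h2
  simp [LinearMap.convMul_def, LinearMap.convOne_def, hg.comul_eq_tmul_self, hg.counit_eq_one]
    at h1' h2'
  exact ⟨⟨_, _, h1', h2'⟩, rfl⟩

end ComoduleAlgebra

namespace Lens

variable {q : ℝ} {l : ℕ}

theorem not_isCleft (hq : q ≠ 0) (hl : 0 < l) : ¬ (comodule q hl).IsCleft := by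
  rintro ⟨j, hj, hcol, -⟩
  have hT : IsGroupLikeElem ℂ (LaurentPolynomial.T 1 : ℂ[T;T⁻¹]) := ⟨by simp, by simp⟩
  obtain ⟨z, hz, hjz⟩ := (isUnit_iff hq _).1
    (ComoduleAlgebra.isUnit_apply_of_isGroupLikeElem hj hT)
  have h := LinearMap.congr_fun hcol (LaurentPolynomial.T 1)
  rw [LinearMap.comp_apply, LinearMap.comp_apply, hT.comul_eq_tmul_self, LinearMap.rTensor_tmul,
    hjz, AlgHom.toLinearMap_apply, AlgHom.commutes] at h
  -- Now `h` reads $z\otimes 1=z\otimes u$; its degree $0$ part is $z\cdot 1=0$, contradicting `hz`.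
  have h0 := congrArg (component (Lens q l) (0 : ℤ)) h
  rw [Algebra.TensorProduct.algebraMap_apply, component_tmul, component_tmul] at h0
  have := SUq.nontrivial hq
  rw [LaurentPolynomial.T, AddMonoidAlgebra.one_def,
    AddMonoidAlgebra.coeff_single, AddMonoidAlgebra.coeff_single,
    Finsupp.single_eq_same, Finsupp.single_eq_of_ne (by decide), one_smul, zero_smul,
    Algebra.algebraMap_eq_smul_one] at h0
  simp at h0
  exact hz h0

end Lens

end QuantumLens

end

theorem lemma3p4 (q : ℝ) (hq0 : 0 < q) (hq1 : q < 1) (l : ℕ) (hl : 0 < l) :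
    (∀ x : QuantumLens.Lens q l,
      IsUnit x ↔ ∃ z : ℂ, z ≠ 0 ∧ x = algebraMap ℂ (QuantumLens.Lens q l) z) ∧
    ¬ (QuantumLens.Lens.comodule q hl).IsCleft :=
  ⟨QuantumLens.Lens.isUnit_iff hq0.ne', QuantumLens.Lens.not_isCleft hq0.ne' hl⟩
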